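/- Let $k$ be a commutative ring with identity and let $\lambda,\kappa\in k$. All algebras, linear maps and tensor products are over $k$; algebras are unital and homomorphisms preserve the unit. An \emph{extended Rota-Baxter operator of weight $(\lambda,\kappa)$} on a commutative algebra $R$ is a linear map $P:R\to R$ with $$P(x)P(y)=P(xP(y))+P(P(x)y)+\lambda P(xy)+\kappa xy\qquad(x,y\in R),$$ and $(R,P)$ is then a commutative extended Rota-Baxter algebra. A homomorphism $(R_1,P_1)\to(R_2,P_2)$ of such algebras is an algebra homomorphism $f$ with $f\circ P_1=P_2\circ f$. For a commutative algebra $A$, let $\text{Ш}_e(A)=\bigoplus_{n\ge 1}A^{\otimes n}$, let $j_A:A\to \text{Ш}_e(A)$ be the inclusion of the first summand, and let $P(\mathfrak a)=1_A\otimes\mathfrak a$. Equip $\text{Ш}_e(A)$ with the bilinear product determined recursively by $$a\cdot b=ab,\qquad a\cdot(b\otimes\mathfrak b)=(b\otimes\mathfrak b)\cdot a=ab\otimes\mathfrak b,$$ $$(a\otimes\mathfrak a)\cdot(b\otimes\mathfrak b)=ab\otimes\big(\mathfrak a\cdot(1_A\otimes\mathfrak b)+(1_A\otimes\mathfrak a)\cdot\mathfrak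 b+\lambda\,\mathfrak a\cdot\mathfrak b\big)+\kappa\,ab\cdot(\mathfrak a\cdot\mathfrak b)$$ for $a,b\in A$ and $\mathfrak a\in A^{\otimes m}$, $\mathfrak b\in A^{\otimes n}$, $m,n\ge1$. This is a commutative algebra with identity $1_A\in A=A^{\otimes 1}$. \textbf{Theorem.} Let $A$ be a commutative bialgebra with coproduct $\Delta_A$ and counit $\varepsilon_A$, and let $\mu\in k$ satisfy $\mu^2-\lambda\mu+\kappa=0$. Then: 1. $P$ and $-\mu\,\mathrm{id}_k$ are extended Rota-Baxter operators of weight $(\lambda,\kappa)$ on $\text{Ш}_e(A)$ and on $k$, and there is a unique homomorphism of extended Rota-Baxter algebras $\varepsilon:(\text{Ш}_e(A),P)\to(k,-\mu\,\mathrm{id}_k)$ with $\varepsilon\circ j_A=\varepsilon_A$ (in particular $\varepsilon\circ P=-\mu\,\varepsilon$). 2. The linear operator $\bar P$ on $\text{Ш}_e(A)\otimes \text{Ш}_e(A)$ given by $$\bar P(\mathfrak a\otimes\mathfrak b)=P(\mathfrak a)\otimes\varepsilon(\mathfrak b)1_A+\mu\,\mathfrak a\otimes\varepsilon(\mathfrak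 b)1_A+\mathfrak a\otimes P(\mathfrak b)$$ is an extended Rota-Baxter operator of weight $(\lambda,\kappa)$, and there is a unique homomorphism of extended Rota-Baxter algebras $\Delta:(\text{Ш}_e(A),P)\to(\text{Ш}_e(A)\otimes \text{Ш}_e(A),\bar P)$ with $\Delta\circ j_A=(j_A\otimes j_A)\circ\Delta_A$. 3. With the above product, the unit map $c\mapsto c\,1_A$, the coproduct $\Delta$ and the counit $\varepsilon$, $\text{Ш}_e(A)$ is a bialgebra. -/

import Mathlib

open scoped TensorProduct DirectSum

noncomputable section

namespace ExtRB

universe u v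

section Operators

variable {k : Type*} [CommRing k]

/-- `P` is an extended Rota-Baxter operator of double weight `(lam, kap)` on the algebra `R`. -/
def IsExtRotaBaxter {R : Type*} [CommRing R] [Algebra k R] (lam kap : k) (P : R →ₗ[k] R) : Prop :=
  ∀ x y : R, P x * P y = P (x * P y) + P (P x * y) + lam • P (x * y) + kap • (x * y)

/-- `f : (R₁, P₁) → (R₂, P₂)` is a homomorphism of commutative extended Rota-Baxter algebras of
weight `(lam, kap)`: source and target are such algebras, and the algebra homomorphism `f`
intertwines the operators. -/
structure IsExtRotaBaxterHom {R₁ R₂ : Type*} [CommRing R₁] [Algebra k R₁] [CommRing R₂]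
    [Algebra k R₂] (lam kap : k) (P₁ : R₁ →ₗ[k] R₁) (P₂ : R₂ →ₗ[k] R₂) (f : R₁ →ₐ[k] R₂) :
    Prop where
  source : IsExtRotaBaxter lam kap P₁
  target : IsExtRotaBaxter lam kap P₂
  comm : ∀ x : R₁, f (P₁ x) = P₂ (f x)

end Operators

section Raw

variable (k : Type u) [CommRing k] (A : Type v) [CommRing A] [Algebra k A]

/-- The module `⨁_{n ≥ 1} A^{⊗ n}`; the summand with index `n` is `A^{⊗ (n + 1)}`. -/
abbrev Raw : Type (max u v) := ⨁ n : ℕ, ⨂[k]^(n + 1) A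

/-- `A ⊗ A^{⊗ n} ≃ A^{⊗ (n + 1)}`, `a ⊗ (a₁ ⊗ ⋯ ⊗ aₙ) ↦ a ⊗ a₁ ⊗ ⋯ ⊗ aₙ`. -/
def consEquiv (n : ℕ) : A ⊗[k] (⨂[k]^n A) ≃ₗ[k] ⨂[k]^(n + 1) A :=
  (TensorProduct.congr
      (PiTensorProduct.subsingletonEquiv (R := k) (s := fun _ => A) (0 : Fin 1)).symm
      (LinearEquiv.refl k (⨂[k]^n A))).trans
    (TensorPower.mulEquiv.trans (TensorPower.cast k A (Nat.add_comm 1 n)))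

theorem consEquiv_tmul_tprod (n : ℕ) (a : A) (v : Fin n → A) :
    consEquiv k A n (a ⊗ₜ PiTensorProduct.tprod k v) =
      PiTensorProduct.tprod k (Fin.cons a v : Fin (n + 1) → A) := by
  simp only [consEquiv, LinearEquiv.trans_apply, TensorProduct.congr_tmul,
    LinearEquiv.refl_apply]
  rw [PiTensorProduct.subsingletonEquiv_symm_apply']
  have h := TensorPower.tprod_mul_tprod k (fun _ : Fin 1 => a) v
  rw [TensorPower.gMul_def] at h
  rw [h, TensorPower.cast_tprod]
  congr 1
  funext i
  refine Fin.cases ?_ (fun j => ?_) i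
  · simp [Fin.append, Fin.addCases]
  · simp [Fin.append, Fin.addCases, Fin.subNat]

/-- `A ≃ A^{⊗ 1}`. -/
def singleEquiv : A ≃ₗ[k] ⨂[k]^(0 + 1) A :=
  (PiTensorProduct.subsingletonEquiv (R := k) (s := fun _ => A) (0 : Fin 1)).symm

/-- The embedding of `A` as the summand `A^{⊗ 1}`. -/
def rawInc : A →ₗ[k] Raw k A :=
  DirectSum.lof k ℕ (fun n => ⨂[k]^(n + 1) A) 0 ∘ₗ (singleEquiv k A).toLinearMap

/-- `rawCons a x = a ⊗ x`, raising the tensor degree by one. -/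
def rawCons : A →ₗ[k] Raw k A →ₗ[k] Raw k A :=
  (DirectSum.toModule k ℕ (A →ₗ[k] Raw k A) fun n =>
    ((TensorProduct.mk k A (⨂[k]^(n + 1) A)).compr₂
      (DirectSum.lof k ℕ (fun n => ⨂[k]^(n + 1) A) (n + 1) ∘ₗ
        (consEquiv k A (n + 1)).toLinearMap)).flip).flip

/-- `rawScale a (a₀ ⊗ a₁ ⊗ ⋯ ⊗ aₙ) = a a₀ ⊗ a₁ ⊗ ⋯ ⊗ aₙ`. -/
def rawScale : A →ₗ[k] Raw k A →ₗ[k] Raw k A :=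
  (DirectSum.toModule k ℕ (A →ₗ[k] Raw k A) fun n =>
    (((LinearMap.rTensorHom (⨂[k]^n A) ∘ₗ LinearMap.mul k A).compl₂
      (consEquiv k A n).symm.toLinearMap).compr₂
        (DirectSum.lof k ℕ (fun n => ⨂[k]^(n + 1) A) n ∘ₗ (consEquiv k A n).toLinearMap)).flip).flip

variable {k}

/-- The product of homogeneous elements, by recursion on the two tensor degrees. -/
def mulAux (lam kap : k) : ∀ m n : ℕ, ⨂[k]^(m + 1) A →ₗ[k] ⨂[k]^(n + 1) A →ₗ[k] Raw k A
  | 0, n =>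
      (rawScale k A ∘ₗ (singleEquiv k A).symm.toLinearMap).compl₂
        (DirectSum.lof k ℕ (fun n => ⨂[k]^(n + 1) A) n)
  | m + 1, 0 =>
      ((rawScale k A ∘ₗ (singleEquiv k A).symm.toLinearMap).compl₂
        (DirectSum.lof k ℕ (fun n => ⨂[k]^(n + 1) A) (m + 1))).flip
  | m + 1, n + 1 =>
      let one_m : ⨂[k]^(m + 1) A →ₗ[k] ⨂[k]^(m + 1 + 1) A :=
        (consEquiv k A (m + 1)).toLinearMap ∘ₗ TensorProduct.mk k A (⨂[k]^(m + 1) A) 1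
      let one_n : ⨂[k]^(n + 1) A →ₗ[k] ⨂[k]^(n + 1 + 1) A :=
        (consEquiv k A (n + 1)).toLinearMap ∘ₗ TensorProduct.mk k A (⨂[k]^(n + 1) A) 1
      ((TensorProduct.map₂ (LinearMap.mul k A)
            ((mulAux lam kap m (n + 1)).compl₂ one_n + (mulAux lam kap (m + 1) n) ∘ₗ one_m
              + lam • mulAux lam kap m n)).compr₂ (TensorProduct.lift (rawCons k A))
        + kap • (TensorProduct.map₂ (LinearMap.mul k A) (mulAux lam kap m n)).compr₂
            (TensorProduct.lift (rawScale k A))).compl₁₂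
        (consEquiv k A (m + 1)).symm.toLinearMap (consEquiv k A (n + 1)).symm.toLinearMap

/-- The product on `⨁_{n ≥ 1} A^{⊗ n}`. -/
def rawMul (lam kap : k) : Raw k A →ₗ[k] Raw k A →ₗ[k] Raw k A :=
  DirectSum.toModule k ℕ (Raw k A →ₗ[k] Raw k A) fun m =>
    (DirectSum.toModule k ℕ (⨂[k]^(m + 1) A →ₗ[k] Raw k A) fun n =>
      (mulAux A lam kap m n).flip).flip

theorem rawCons_lof (n : ℕ) (a : A) (t : ⨂[k]^(n + 1) A) :
    rawCons k A a (DirectSum.lof k ℕ (fun n => ⨂[k]^(n + 1) A) n t) =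
      DirectSum.lof k ℕ (fun n => ⨂[k]^(n + 1) A) (n + 1) (consEquiv k A (n + 1) (a ⊗ₜ t)) := by
  simp [rawCons]

theorem rawScale_lof (n : ℕ) (a b : A) (t : ⨂[k]^n A) :
    rawScale k A a (DirectSum.lof k ℕ (fun n => ⨂[k]^(n + 1) A) n (consEquiv k A n (b ⊗ₜ t))) =
      DirectSum.lof k ℕ (fun n => ⨂[k]^(n + 1) A) n (consEquiv k A n ((a * b) ⊗ₜ t)) := by
  simp [rawScale]

theorem rawScale_cons (a b : A) (x : Raw k A) :
    rawScale k A a (rawCons k A b x) = rawCons k A (a * b) x := by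
  have : rawScale k A a ∘ₗ rawCons k A b = rawCons k A (a * b) := by
    apply DirectSum.linearMap_ext
    intro n
    refine LinearMap.ext fun t => ?_
    simp [rawCons_lof, rawScale_lof]
  exact LinearMap.congr_fun this x

theorem rawScale_inc (a b : A) : rawScale k A a (rawInc k A b) = rawInc k A (a * b) := by
  have h : ∀ b : A, singleEquiv k A b =
      consEquiv k A 0 (b ⊗ₜ PiTensorProduct.tprod k Fin.elim0) := by
    intro b
    rw [consEquiv_tmul_tprod]
    refine (PiTensorProduct.subsingletonEquiv_symm_apply' (R := k) (0 : Fin 1) b).trans ?_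
    congr 1
    funext i
    fin_cases i
    rfl
  simp only [rawInc, LinearMap.comp_apply, LinearEquiv.coe_coe, h]
  rw [rawScale_lof]

theorem rawScale_mul (a b : A) (x : Raw k A) :
    rawScale k A (a * b) x = rawScale k A a (rawScale k A b x) := by
  have : rawScale k A (a * b) = rawScale k A a ∘ₗ rawScale k A b := by
    apply DirectSum.linearMap_ext
    intro n
    refine LinearMap.ext fun t => ?_
    obtain ⟨t, rfl⟩ := (consEquiv k A n).surjective t
    induction t using TensorProduct.induction_on with
    | zero => simp
    | tmul c t => simp [rawScale_lof, mul_assoc]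
    | add p q hp hq => simp only [map_add, hp, hq]
  exact LinearMap.congr_fun this x

theorem rawScale_one (x : Raw k A) : rawScale k A 1 x = x := by
  have : rawScale k A 1 = LinearMap.id := by
    apply DirectSum.linearMap_ext
    intro n
    refine LinearMap.ext fun t => ?_
    obtain ⟨t, rfl⟩ := (consEquiv k A n).surjective t
    induction t using TensorProduct.induction_on with
    | zero => simp
    | tmul c t => simp [rawScale_lof]
    | add p q hp hq => simp only [map_add, hp, hq]
  exact LinearMap.congr_fun this x

/-- Elements of `A^{⊗ (n + 1)}` inside the direct sum. -/
def IsDeg (n : ℕ) (x : Raw k A) : Prop :=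
  ∃ t, x = DirectSum.lof k ℕ (fun n => ⨂[k]^(n + 1) A) n t

theorem IsDeg.rawCons {n : ℕ} {x : Raw k A} (hx : IsDeg A n x) (a : A) :
    IsDeg A (n + 1) (rawCons k A a x) := by
  obtain ⟨t, rfl⟩ := hx
  exact ⟨_, rawCons_lof A n a t⟩

theorem IsDeg.zero_cases {x : Raw k A} (hx : IsDeg A 0 x) : ∃ a, x = rawInc k A a := by
  obtain ⟨t, rfl⟩ := hx
  obtain ⟨a, rfl⟩ := (singleEquiv k A).surjective t
  exact ⟨a, rfl⟩

theorem IsDeg.succ_induction {n : ℕ} {p : Raw k A → Prop} (h0 : p 0)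
    (hadd : ∀ x y, p x → p y → p (x + y))
    (hcons : ∀ a x, IsDeg A n x → p (ExtRB.rawCons k A a x)) :
    ∀ x, IsDeg A (n + 1) x → p x := by
  rintro _ ⟨t, rfl⟩
  obtain ⟨t, rfl⟩ := (consEquiv k A (n + 1)).surjective t
  induction t using TensorProduct.induction_on with
  | zero => simpa using h0
  | tmul a t =>
    rw [← rawCons_lof]
    exact hcons _ _ ⟨t, rfl⟩
  | add p q hp hq =>
    simp only [map_add]
    exact hadd _ _ hp hq

theorem deg_induction {p : Raw k A → Prop} (hadd : ∀ x y, p x → p y → p (x + y))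
    (h : ∀ n x, IsDeg A n x → p x) : ∀ x, p x := by
  intro x
  induction x using DirectSum.induction_on with
  | zero => exact h 0 0 ⟨0, by simp⟩
  | of i t => exact h i _ ⟨t, rfl⟩
  | add x y hx hy => exact hadd x y hx hy

variable (lam kap : k)

theorem rawMul_lof (m n : ℕ) (s : ⨂[k]^(m + 1) A) (t : ⨂[k]^(n + 1) A) :
    rawMul A lam kap (DirectSum.lof k ℕ (fun n => ⨂[k]^(n + 1) A) m s)
      (DirectSum.lof k ℕ (fun n => ⨂[k]^(n + 1) A) n t) = mulAux A lam kap m n s t := by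
  simp [rawMul]

theorem rawMul_inc_left (a : A) (x : Raw k A) :
    rawMul A lam kap (rawInc k A a) x = rawScale k A a x := by
  induction x using deg_induction with
  | hadd x y hx hy => simp only [map_add, hx, hy]
  | h n x hx =>
    obtain ⟨t, rfl⟩ := hx
    simp [rawInc, rawMul_lof, mulAux]

theorem rawMul_inc_right (a : A) (x : Raw k A) :
    rawMul A lam kap x (rawInc k A a) = rawScale k A a x := by
  induction x using deg_induction with
  | hadd x y hx hy => simp only [map_add, hx, hy, LinearMap.add_apply]
  | h n x hx =>
    cases n with
    | zero =>
      obtain ⟨b, rfl⟩ := hx.zero_cases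
      rw [rawMul_inc_left, rawScale_inc, rawScale_inc, mul_comm]
    | succ n =>
      obtain ⟨t, rfl⟩ := hx
      simp [rawInc, rawMul_lof, mulAux]

/-- The recursion that defines the product of two tensors of degree at least two:
`(a ⊗ x)(b ⊗ y) = ab ⊗ (x(1 ⊗ y) + (1 ⊗ x)y + lam xy) + kap ab(xy)`. -/
theorem rawMul_cons_cons (a b : A) (x y : Raw k A) :
    rawMul A lam kap (rawCons k A a x) (rawCons k A b y) =
      rawCons k A (a * b) (rawMul A lam kap x (rawCons k A 1 y)
        + rawMul A lam kap (rawCons k A 1 x) y + lam • rawMul A lam kap x y)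
      + kap • rawScale k A (a * b) (rawMul A lam kap x y) := by
  induction x using deg_induction with
  | hadd x x' hx hx' => simp only [map_add, hx, hx', LinearMap.add_apply, smul_add]; abel
  | h m x hx =>
    induction y using deg_induction with
    | hadd y y' hy hy' => simp only [map_add, hy, hy', smul_add]; abel
    | h n y hy =>
      obtain ⟨s, rfl⟩ := hx
      obtain ⟨t, rfl⟩ := hy
      simp only [rawCons_lof, rawMul_lof]
      rw [mulAux]
      simp

theorem rawMul_comm (x y : Raw k A) : rawMul A lam kap x y = rawMul A lam kap y x := by
  have key : ∀ m n x y, IsDeg A m x → IsDeg A n y →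
      rawMul A lam kap x y = rawMul A lam kap y x := by
    intro m
    induction m with
    | zero =>
      intro n x y hx _
      obtain ⟨a, rfl⟩ := hx.zero_cases
      rw [rawMul_inc_left, rawMul_inc_right]
    | succ m ihm =>
      intro n
      induction n with
      | zero =>
        intro x y _ hy
        obtain ⟨a, rfl⟩ := hy.zero_cases
        rw [rawMul_inc_left, rawMul_inc_right]
      | succ n ihn =>
        intro x y hx hy
        refine IsDeg.succ_induction A (p := fun x => rawMul A lam kap x y = rawMul A lam kap y x)
          (by simp) (fun x x' h h' => by simp only [map_add, LinearMap.add_apply, h, h']) ?_ x hx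
        intro a x hx
        refine IsDeg.succ_induction A (p := fun y => rawMul A lam kap (rawCons k A a x) y =
          rawMul A lam kap y (rawCons k A a x))
          (by simp) (fun x x' h h' => by simp only [map_add, LinearMap.add_apply, h, h']) ?_ y hy
        intro b y hy
        rw [rawMul_cons_cons, rawMul_cons_cons, ihm _ _ _ hx (hy.rawCons A 1),
          ihn _ _ (hx.rawCons A 1) hy, ihm _ _ _ hx hy, mul_comm a b]
        congr 2
        abel
  induction x using deg_induction with
  | hadd x x' hx hx' => simp only [map_add, LinearMap.add_apply, hx, hx']
  | h m x hx =>
    induction y using deg_induction with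
    | hadd x x' hx hx' => simp only [map_add, LinearMap.add_apply, hx, hx']
    | h n y hy => exact key m n x y hx hy

theorem rawMul_scale_left (a : A) (x y : Raw k A) :
    rawMul A lam kap (rawScale k A a x) y = rawScale k A a (rawMul A lam kap x y) := by
  induction x using deg_induction with
  | hadd x x' hx hx' => simp only [map_add, LinearMap.add_apply, hx, hx']
  | h m x hx =>
    cases m with
    | zero =>
      obtain ⟨b, rfl⟩ := hx.zero_cases
      rw [rawScale_inc, rawMul_inc_left, rawMul_inc_left, rawScale_mul]
    | succ m =>
      refine IsDeg.succ_induction A (p := fun x => rawMul A lam kap (rawScale k A a x) y =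
        rawScale k A a (rawMul A lam kap x y))
        (by simp) (fun x x' h h' => by simp only [map_add, LinearMap.add_apply, h, h']) ?_ x hx
      intro b x hx
      induction y using deg_induction with
      | hadd x x' hx hx' => simp only [map_add, hx, hx']
      | h n y hy =>
        cases n with
        | zero =>
          obtain ⟨c, rfl⟩ := hy.zero_cases
          rw [rawMul_inc_right, rawMul_inc_right, ← rawScale_mul, ← rawScale_mul, mul_comm]
        | succ n =>
          refine IsDeg.succ_induction A
            (p := fun y => rawMul A lam kap (rawScale k A a (rawCons k A b x)) y =
              rawScale k A a (rawMul A lam kap (rawCons k A b x) y))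
            (by simp) (fun x x' h h' => by simp only [map_add, h, h']) ?_ y hy
          intro c y hy
          simp only [rawScale_cons, rawMul_cons_cons, map_add, map_smul, ← rawScale_mul, mul_assoc]

theorem rawMul_scale_right (a : A) (x y : Raw k A) :
    rawMul A lam kap x (rawScale k A a y) = rawScale k A a (rawMul A lam kap x y) := by
  rw [rawMul_comm, rawMul_scale_left, rawMul_comm]

theorem rawCons_eq (a : A) (x : Raw k A) :
    rawCons k A a x = rawScale k A a (rawCons k A 1 x) := by
  rw [rawScale_cons, mul_one]

theorem rawMul_assoc (x y z : Raw k A) :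
    rawMul A lam kap (rawMul A lam kap x y) z = rawMul A lam kap x (rawMul A lam kap y z) := by
  have key : ∀ N m n r x y z, m + n + r ≤ N → IsDeg A m x → IsDeg A n y → IsDeg A r z →
      rawMul A lam kap (rawMul A lam kap x y) z = rawMul A lam kap x (rawMul A lam kap y z) := by
    intro N
    induction N with
    | zero =>
      intro m n r x y z hN hx hy hz
      obtain rfl : m = 0 := by omega
      obtain ⟨a, rfl⟩ := hx.zero_cases
      rw [rawMul_inc_left, rawMul_inc_left, rawMul_scale_left]
    | succ N ih =>
      intro m n r x y z hN hx hy hz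
      rcases m with _ | m
      · obtain ⟨a, rfl⟩ := hx.zero_cases
        rw [rawMul_inc_left, rawMul_inc_left, rawMul_scale_left]
      rcases n with _ | n
      · obtain ⟨a, rfl⟩ := hy.zero_cases
        rw [rawMul_inc_left, rawMul_inc_right, rawMul_scale_left, rawMul_scale_right]
      rcases r with _ | r
      · obtain ⟨a, rfl⟩ := hz.zero_cases
        rw [rawMul_inc_right, rawMul_inc_right, rawMul_scale_right]
      refine IsDeg.succ_induction A (p := fun x => rawMul A lam kap (rawMul A lam kap x y) z =
        rawMul A lam kap x (rawMul A lam kap y z))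
        (by simp) (fun x x' h h' => by simp only [map_add, LinearMap.add_apply, h, h']) ?_ x hx
      intro a x hx
      refine IsDeg.succ_induction A (p := fun y => rawMul A lam kap
        (rawMul A lam kap (rawCons k A a x) y) z =
        rawMul A lam kap (rawCons k A a x) (rawMul A lam kap y z))
        (by simp) (fun x x' h h' => by simp only [map_add, LinearMap.add_apply, h, h']) ?_ y hy
      intro b y hy
      refine IsDeg.succ_induction A (p := fun z => rawMul A lam kap
        (rawMul A lam kap (rawCons k A a x) (rawCons k A b y)) z =
        rawMul A lam kap (rawCons k A a x) (rawMul A lam kap (rawCons k A b y) z))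
        (by simp) (fun x x' h h' => by simp only [map_add, h, h']) ?_ z hz
      intro c z hz
      rw [rawCons_eq A a, rawCons_eq A b, rawCons_eq A c]
      simp only [rawMul_scale_left, rawMul_scale_right]
      congr 3
      have hx1 := hx.rawCons A 1
      have hy1 := hy.rawCons A 1
      have hz1 := hz.rawCons A 1
      have e1 := ih m n r x y z (by omega) hx hy hz
      have e2 := ih (m+1) n r _ y z (by omega) hx1 hy hz
      have e3 := ih m (n+1) r x _ z (by omega) hx hy1 hz
      have e4 := ih m n (r+1) x y _ (by omega) hx hy hz1
      have e5 := ih (m+1) (n+1) r _ _ z (by omega) hx1 hy1 hz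
      have e6 := ih (m+1) n (r+1) _ y _ (by omega) hx1 hy hz1
      have e7 := ih m (n+1) (r+1) x _ _ (by omega) hx hy1 hz1
      have hxy := rawMul_cons_cons A lam kap 1 1 x y
      have hyz := rawMul_cons_cons A lam kap 1 1 y z
      simp only [mul_one, rawScale_one] at hxy hyz
      generalize hw : rawMul A lam kap x (rawCons k A 1 y)
        + rawMul A lam kap (rawCons k A 1 x) y + lam • rawMul A lam kap x y = w at hxy
      generalize hv : rawMul A lam kap y (rawCons k A 1 z)
        + rawMul A lam kap (rawCons k A 1 y) z + lam • rawMul A lam kap y z = v at hyz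
      have hxy' := eq_sub_of_add_eq hxy.symm
      have hyz' := eq_sub_of_add_eq hyz.symm
      have h1 := rawMul_cons_cons A lam kap 1 1 w z
      have h2 := rawMul_cons_cons A lam kap 1 1 x v
      simp only [mul_one, rawScale_one] at h1 h2
      rw [hxy, hyz, map_add, LinearMap.add_apply, map_add, h1, h2, hxy', hyz', ← hw, ← hv]
      simp only [map_add, map_sub, map_smul, LinearMap.add_apply, LinearMap.smul_apply,
        LinearMap.sub_apply, e1, e2, e3, e4, e5, e6, e7]
      module
  induction x using deg_induction with
  | hadd x x' hx hx' => simp only [map_add, LinearMap.add_apply, hx, hx']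
  | h m x hx =>
    induction y using deg_induction with
    | hadd x x' hx hx' => simp only [map_add, LinearMap.add_apply, hx, hx']
    | h n y hy =>
      induction z using deg_induction with
      | hadd x x' hx hx' => simp only [map_add, hx, hx']
      | h r z hz => exact key _ m n r x y z le_rfl hx hy hz

end Raw

section Sha

variable {k : Type u} [CommRing k] (A : Type v) [CommRing A] [Algebra k A] (lam kap : k)

/-- The module `A ⊕ A^{⊗ 2} ⊕ ⋯`, equipped below with the product of weight `(lam, kap)`. -/
def Sha (_lam _kap : k) : Type (max u v) := Raw k A

instance : AddCommGroup (Sha A lam kap) := inferInstanceAs (AddCommGroup (Raw k A))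

instance : Module k (Sha A lam kap) := inferInstanceAs (Module k (Raw k A))

instance : CommRing (Sha A lam kap) :=
  { (inferInstance : AddCommGroup (Sha A lam kap)) with
    mul := fun x y => rawMul A lam kap x y
    one := rawInc k A 1
    left_distrib := fun x y z => (rawMul A lam kap x).map_add y z
    right_distrib := fun x y z => (rawMul A lam kap).map_add₂ x y z
    zero_mul := fun x => (rawMul A lam kap).map_zero₂ x
    mul_zero := fun x => (rawMul A lam kap x).map_zero
    mul_assoc := rawMul_assoc A lam kap
    mul_comm := rawMul_comm A lam kap
    one_mul := fun x => (rawMul_inc_left A lam kap 1 x).trans (rawScale_one A x)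
    mul_one := fun x => (rawMul_inc_right A lam kap 1 x).trans (rawScale_one A x) }

instance : Algebra k (Sha A lam kap) :=
  Algebra.ofModule (fun r x y => (rawMul A lam kap).map_smul₂ r x y)
    (fun r x y => (rawMul A lam kap x).map_smul r y)

/-- The natural embedding `j_A : A → A ⊕ A^{⊗ 2} ⊕ ⋯` as the first summand. -/
def Sha.incl : A →ₐ[k] Sha A lam kap :=
  AlgHom.ofLinearMap (rawInc k A : A →ₗ[k] Sha A lam kap) rfl fun a b =>
    ((rawMul_inc_left A lam kap a (rawInc k A b)).trans (rawScale_inc A a b)).symm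

/-- The tensor prefixing map `a, x ↦ a ⊗ x`, for `a` in `A`. -/
def Sha.cons : A →ₗ[k] Sha A lam kap →ₗ[k] Sha A lam kap := rawCons k A

/-- The right-shift operator `x ↦ 1 ⊗ x`. -/
def Sha.shift : Sha A lam kap →ₗ[k] Sha A lam kap := Sha.cons A lam kap 1

/-- `j_A(a) (b ⊗ y) = ab ⊗ y`. -/
theorem Sha.incl_mul_cons (a b : A) (y : Sha A lam kap) :
    Sha.incl A lam kap a * Sha.cons A lam kap b y = Sha.cons A lam kap (a * b) y :=
  (rawMul_inc_left A lam kap a _).trans (rawScale_cons A a b y)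

/-- The defining recursion of the product:
`(a ⊗ x)(b ⊗ y) = ab ⊗ (x(1 ⊗ y) + (1 ⊗ x)y + lam xy) + kap ab(xy)`. -/
theorem Sha.cons_mul_cons (a b : A) (x y : Sha A lam kap) :
    Sha.cons A lam kap a x * Sha.cons A lam kap b y =
      Sha.cons A lam kap (a * b)
        (x * Sha.cons A lam kap 1 y + Sha.cons A lam kap 1 x * y + lam • (x * y))
      + kap • (Sha.incl A lam kap (a * b) * (x * y)) := by
  refine (rawMul_cons_cons A lam kap a b x y).trans ?_
  rw [← rawMul_inc_left A lam kap]
  rfl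

/-- The operator `Pbar` on `Sha ⊗ Sha` attached to a linear form `ε` on `Sha` and a scalar `mu`:
`Pbar (a ⊗ b) = P a ⊗ ε(b)1 + mu a ⊗ ε(b)1 + a ⊗ P b`, with `P` the right-shift operator. -/
def Sha.pbar (mu : k) (ε : Sha A lam kap →ₗ[k] k) :
    Sha A lam kap ⊗[k] Sha A lam kap →ₗ[k] Sha A lam kap ⊗[k] Sha A lam kap :=
  TensorProduct.map (Sha.shift A lam kap) (Algebra.linearMap k (Sha A lam kap) ∘ₗ ε)
    + mu • TensorProduct.map LinearMap.id (Algebra.linearMap k (Sha A lam kap) ∘ₗ ε)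
    + TensorProduct.map LinearMap.id (Sha.shift A lam kap)

end Sha

end ExtRB

end

open scoped TensorProduct DirectSum

noncomputable section

namespace ExtRB

universe u v w

/-! The algebra `Sha A lam kap` with its shift `P` is the free commutative extended Rota-Baxter
algebra on the algebra `A`: an algebra map from `A` to `R` and an extended Rota-Baxter operator on
`R` determine a unique extension (`lift`, `algHom_ext_of_comm`). Both structure maps are such
extensions. The counit extends the counit of `A` along `-mu` on `k`, which satisfies the identity
because `mu` is a root of the given quadratic. The coproduct extends the coproduct of `A` along
`pbar`, so the main computation is that `pbar` is extended Rota-Baxter (`pbar_isExtRotaBaxter`).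
With `S = P + mu` it reads `x ⊗ y ↦ ε(y) S x ⊗ 1 + x ⊗ P y`, and the quadratic makes `S` an ordinary
Rota-Baxter operator of weight `lam - 2 mu`.

Each coalgebra axiom equates two algebra maps out of `Sha A lam kap`. They agree on `A` because `A`
is a bialgebra, so it suffices that both carry the shift to one common operator on the target: the
shift for the counit laws, `tripleOp` for coassociativity. Uniqueness asks nothing of that operator,
so `tripleOp` need not be shown to be Rota-Baxter. Coassociativity relies on `ε = (ε ⊗ ε) Δ`, a
consequence of the left counit law, so the counit laws come before it. -/

theorem isExtRotaBaxter_neg_smul_id {k : Type*} [CommRing k] {lam kap mu : k}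
    (hmu : mu ^ 2 - lam * mu + kap = 0) :
    IsExtRotaBaxter lam kap ((-mu) • (LinearMap.id : k →ₗ[k] k)) := by
  intro x y
  simp only [LinearMap.smul_apply, LinearMap.id_apply, smul_eq_mul]
  linear_combination (-(x * y)) * hmu

/-! ### Freeness of `Sha A lam kap` over the algebra `A`. -/

section Lift

variable {k : Type u} [CommRing k] {A : Type v} [CommRing A] [Algebra k A] {lam kap : k}
  {R : Type w} [CommRing R] [Algebra k R]

namespace Sha

theorem shift_isExtRotaBaxter : IsExtRotaBaxter lam kap (shift A lam kap) := by
  intro x y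
  have h := cons_mul_cons A lam kap 1 1 x y
  rwa [mul_one, map_one (incl A lam kap), one_mul (x * y), map_add, map_add, map_smul] at h

theorem cons_eq_incl_mul_shift (a : A) (x : Sha A lam kap) :
    cons A lam kap a x = incl A lam kap a * shift A lam kap x := by
  rw [shift, incl_mul_cons, mul_one]

/-- Hides the grading: in the prefixing step `x` need not be homogeneous, so later arguments never
mention tensor degree. -/
theorem induction_on {p : Sha A lam kap → Prop} (x : Sha A lam kap)
    (hincl : ∀ a, p (incl A lam kap a)) (hadd : ∀ x y, p x → p y → p (x + y))
    (hcons : ∀ a x, p x → p (cons A lam kap a x)) : p x := by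
  refine deg_induction A (p := p) hadd (fun n => ?_) x
  induction n with
  | zero =>
    intro x hx
    obtain ⟨a, rfl⟩ := hx.zero_cases
    exact hincl a
  | succ n ih =>
    refine IsDeg.succ_induction A (p := p) ?_ hadd fun a x hx => hcons a x (ih x hx)
    have h := hincl 0
    rwa [map_zero] at h

/-- An algebra homomorphism that intertwines the shift with some operator is determined by its
values on `A`. -/
theorem algHom_ext_of_comm {Q : R → R} {f g : Sha A lam kap →ₐ[k] R}
    (hf : ∀ x, f (shift A lam kap x) = Q (f x)) (hg : ∀ x, g (shift A lam kap x) = Q (g x))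
    (h : ∀ a, f (incl A lam kap a) = g (incl A lam kap a)) : f = g := by
  refine AlgHom.ext fun x => ?_
  induction x using induction_on with
  | hincl a => exact h a
  | hadd x y hx hy => rw [map_add, map_add, hx, hy]
  | hcons a x hx => rw [cons_eq_incl_mul_shift, map_mul, map_mul, h, hf, hg, hx]

/-- The homogeneous components of the linear map `a₀ ⊗ x ↦ f a₀ * Q (⋯ x)`. -/
def liftAux (f : A →ₐ[k] R) (Q : R →ₗ[k] R) : ∀ n : ℕ, ⨂[k]^(n + 1) A →ₗ[k] R
  | 0 => f.toLinearMap ∘ₗ (singleEquiv k A).symm.toLinearMap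
  | n + 1 => TensorProduct.lift ((LinearMap.mul k R).compl₁₂ f.toLinearMap (Q ∘ₗ liftAux f Q n))
      ∘ₗ (consEquiv k A (n + 1)).symm.toLinearMap

variable (lam kap) in
/-- The linear map `Sha A → R` with `a ↦ f a` and `a ⊗ x ↦ f a * Q (x)`. -/
def liftLinear (f : A →ₐ[k] R) (Q : R →ₗ[k] R) : Sha A lam kap →ₗ[k] R :=
  (DirectSum.toModule k ℕ R (liftAux f Q) : Raw k A →ₗ[k] R)

theorem liftLinear_incl (f : A →ₐ[k] R) (Q : R →ₗ[k] R) (a : A) :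
    liftLinear lam kap f Q (incl A lam kap a) = f a := by
  change (DirectSum.toModule k ℕ R (liftAux f Q) : Raw k A →ₗ[k] R) (rawInc k A a) = f a
  simp [rawInc, liftAux]

theorem liftLinear_cons (f : A →ₐ[k] R) (Q : R →ₗ[k] R) (a : A) (x : Sha A lam kap) :
    liftLinear lam kap f Q (cons A lam kap a x) = f a * Q (liftLinear lam kap f Q x) := by
  change (DirectSum.toModule k ℕ R (liftAux f Q) : Raw k A →ₗ[k] R) (rawCons k A a x) =
    f a * Q ((DirectSum.toModule k ℕ R (liftAux f Q) : Raw k A →ₗ[k] R) x)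
  induction x using deg_induction with
  | hadd x y hx hy => simp only [map_add, hx, hy, mul_add]
  | h n x hx =>
    obtain ⟨t, rfl⟩ := hx
    rw [rawCons_lof]
    simp [liftAux]

theorem liftLinear_shift (f : A →ₐ[k] R) (Q : R →ₗ[k] R) (x : Sha A lam kap) :
    liftLinear lam kap f Q (shift A lam kap x) = Q (liftLinear lam kap f Q x) := by
  rw [shift, liftLinear_cons, map_one, one_mul]

/-- Multiplying by an element of `A` only changes the first tensor factor, so multiplicativity of
`f` suffices and `Q` may be any linear map. -/
theorem liftLinear_incl_mul (f : A →ₐ[k] R) (Q : R →ₗ[k] R) (a : A) (x : Sha A lam kap) :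
    liftLinear lam kap f Q (incl A lam kap a * x) = f a * liftLinear lam kap f Q x := by
  induction x using induction_on with
  | hincl b => rw [← map_mul, liftLinear_incl, liftLinear_incl, map_mul]
  | hadd x y hx hy => rw [mul_add, map_add, map_add, hx, hy, mul_add]
  | hcons b x hx => rw [incl_mul_cons, liftLinear_cons, liftLinear_cons, map_mul, mul_assoc]

/-- The recursion for the product of two prefixed tensors is the Rota-Baxter identity multiplied by
`ab`, so the identity for `Q` matches it term by term. -/
theorem liftLinear_mul (f : A →ₐ[k] R) {Q : R →ₗ[k] R} (hQ : IsExtRotaBaxter lam kap Q)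
    (x y : Sha A lam kap) :
    liftLinear lam kap f Q (x * y) = liftLinear lam kap f Q x * liftLinear lam kap f Q y := by
  induction x using induction_on generalizing y with
  | hincl a => rw [liftLinear_incl_mul, liftLinear_incl]
  | hadd x x' hx hx' => rw [add_mul, map_add, map_add, hx, hx', add_mul]
  | hcons a x ihx =>
    -- The recursion produces `x (1 ⊗ y)` and `(1 ⊗ x) y`. The first needs the outer hypothesis at a
    -- different second factor, the second needs the inner hypothesis with `a` replaced by `1`;
    -- hence both generalizations.
    induction y using induction_on generalizing a with
    | hincl b => rw [mul_comm, liftLinear_incl_mul, liftLinear_incl, mul_comm]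
    | hadd y y' hy hy' => rw [mul_add, map_add, map_add, hy, hy', mul_add]
    | hcons b y ihy =>
      have h1 : liftLinear lam kap f Q (x * cons A lam kap 1 y) =
          liftLinear lam kap f Q x * Q (liftLinear lam kap f Q y) := by
        rw [ihx, liftLinear_cons, map_one, one_mul]
      have h2 : liftLinear lam kap f Q (cons A lam kap 1 x * y) =
          Q (liftLinear lam kap f Q x) * liftLinear lam kap f Q y := by
        rw [ihy, liftLinear_cons, map_one, one_mul]
      rw [cons_mul_cons, map_add, liftLinear_cons, map_smul, liftLinear_incl_mul,
        map_add (liftLinear lam kap f Q), map_add (liftLinear lam kap f Q), map_smul, h1, h2, ihx, liftLinear_cons, liftLinear_cons, map_add, map_add, map_smul,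
        map_mul, mul_mul_mul_comm (f a) (Q _), hQ, mul_add _ _ (kap • _), mul_smul_comm]

/-- The homomorphism of extended Rota-Baxter algebras that extends `f : A → R`. -/
def lift (f : A →ₐ[k] R) {Q : R →ₗ[k] R} (hQ : IsExtRotaBaxter lam kap Q) :
    Sha A lam kap →ₐ[k] R :=
  AlgHom.ofLinearMap (liftLinear lam kap f Q)
    (by rw [← map_one (incl A lam kap), liftLinear_incl, map_one]) (liftLinear_mul f hQ)

theorem lift_incl (f : A →ₐ[k] R) {Q : R →ₗ[k] R} (hQ : IsExtRotaBaxter lam kap Q) (a : A) :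
    lift f hQ (incl A lam kap a) = f a :=
  liftLinear_incl f Q a

theorem lift_shift (f : A →ₐ[k] R) {Q : R →ₗ[k] R} (hQ : IsExtRotaBaxter lam kap Q)
    (x : Sha A lam kap) : lift f hQ (shift A lam kap x) = Q (lift f hQ x) :=
  liftLinear_shift f Q x

theorem lift_isExtRotaBaxterHom (f : A →ₐ[k] R) {Q : R →ₗ[k] R}
    (hQ : IsExtRotaBaxter lam kap Q) :
    IsExtRotaBaxterHom lam kap (shift A lam kap) Q (lift f hQ) :=
  ⟨shift_isExtRotaBaxter, hQ, lift_shift f hQ⟩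

end Sha

end Lift

section Bialgebra

variable {k : Type u} [CommRing k] {A : Type v} [CommRing A] {lam kap mu : k}

namespace Sha

/-! ### The operator `pbar` and its compatibility with the counit and the coproduct. -/

section Pbar

variable [Algebra k A]

variable (A lam kap mu) in
/-- The operator `P + mu id`. -/
def shiftAdd : Sha A lam kap →ₗ[k] Sha A lam kap :=
  shift A lam kap + mu • LinearMap.id

theorem shiftAdd_apply (x : Sha A lam kap) :
    shiftAdd A lam kap mu x = shift A lam kap x + mu • x :=
  rfl

theorem pbar_tmul (ε : Sha A lam kap →ₗ[k] k) (x y : Sha A lam kap) :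
    pbar A lam kap mu ε (x ⊗ₜ y) =
      ε y • shiftAdd A lam kap mu x ⊗ₜ[k] (1 : Sha A lam kap) + x ⊗ₜ shift A lam kap y := by
  simp only [pbar, LinearMap.add_apply, LinearMap.smul_apply, TensorProduct.map_tmul,
    LinearMap.comp_apply, LinearMap.id_apply, Algebra.linearMap_apply, shiftAdd_apply,
    Algebra.algebraMap_eq_smul_one, TensorProduct.tmul_smul, TensorProduct.add_tmul,
    TensorProduct.smul_tmul', smul_add, smul_smul, mul_comm mu]

/-- Translating an extended Rota-Baxter operator by `mu` changes the weight `(lam, kap)` to `(lam -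
2 mu, mu² - lam mu + kap)`; the second entry vanishes by `hmu`. -/
theorem shiftAdd_mul (hmu : mu ^ 2 - lam * mu + kap = 0) (x y : Sha A lam kap) :
    shiftAdd A lam kap mu x * shiftAdd A lam kap mu y =
      shiftAdd A lam kap mu (x * shiftAdd A lam kap mu y)
        + shiftAdd A lam kap mu (shiftAdd A lam kap mu x * y)
        + (lam - 2 * mu) • shiftAdd A lam kap mu (x * y) := by
  have h := shift_isExtRotaBaxter (A := A) (lam := lam) (kap := kap) x y
  simp only [shiftAdd_apply, add_mul, mul_add, smul_mul_assoc, mul_smul_comm, h, map_add, map_smul]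
  match_scalars
  all_goals first | ring1 | linear_combination hmu

theorem pbar_isExtRotaBaxter (hmu : mu ^ 2 - lam * mu + kap = 0) {ε : Sha A lam kap →ₐ[k] k}
    (hε : ∀ x, ε (shift A lam kap x) = -mu * ε x) :
    IsExtRotaBaxter lam kap (pbar A lam kap mu ε.toLinearMap) := by
  intro X Y
  induction X using TensorProduct.induction_on with
  | zero => simp only [map_zero, zero_mul, smul_zero, add_zero]
  | add X X' hX hX' => simp only [map_add, add_mul, hX, hX', smul_add]; abel
  | tmul a b =>
    induction Y using TensorProduct.induction_on with
    | zero => simp only [map_zero, mul_zero, smul_zero, add_zero]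
    | add Y Y' hY hY' => simp only [map_add, mul_add, hY, hY', smul_add]; abel
    | tmul c d =>
      -- The two mixed terms of the identity each contribute `-mu ε(b) ε(d) S(ac) ⊗ 1` through `ε P
      -- = -mu ε`. Together with the `lam` term this gives the coefficient `lam - 2 mu` required by
      -- `h1`; the right tensor factor uses `h2`.
      have h1 := shiftAdd_mul hmu a c
      have h2 := shift_isExtRotaBaxter (A := A) (lam := lam) (kap := kap) b d
      simp only [pbar_tmul, AlgHom.toLinearMap_apply, mul_add, add_mul,
        Algebra.TensorProduct.tmul_mul_tmul, mul_one, one_mul, smul_mul_assoc, mul_smul_comm,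
        map_add, map_smul, map_mul, hε, h1, h2, TensorProduct.add_tmul, TensorProduct.tmul_add,
        TensorProduct.tmul_smul, ← TensorProduct.smul_tmul', smul_add]
      module

/-- `ε` kills the image of `P + mu`, so only the term `x ⊗ P y` survives. -/
theorem lid_map_pbar {ε : Sha A lam kap →ₐ[k] k}
    (hε : ∀ x, ε (shift A lam kap x) = -mu * ε x) (X : Sha A lam kap ⊗[k] Sha A lam kap) :
    Algebra.TensorProduct.lid k (Sha A lam kap) (Algebra.TensorProduct.map ε (AlgHom.id k _)
        (pbar A lam kap mu ε.toLinearMap X)) =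
      shift A lam kap (Algebra.TensorProduct.lid k (Sha A lam kap)
        (Algebra.TensorProduct.map ε (AlgHom.id k _) X)) := by
  induction X using TensorProduct.induction_on with
  | zero => simp only [map_zero]
  | add X Y hX hY => simp only [map_add, hX, hY]
  | tmul x y => simp [pbar_tmul, shiftAdd_apply, hε]

/-- Here `ε(P y) = -mu ε(y)` cancels the `mu` in `P + mu`. -/
theorem rid_map_pbar {ε : Sha A lam kap →ₐ[k] k}
    (hε : ∀ x, ε (shift A lam kap x) = -mu * ε x) (X : Sha A lam kap ⊗[k] Sha A lam kap) :
    Algebra.TensorProduct.rid k k (Sha A lam kap) (Algebra.TensorProduct.map (AlgHom.id k _) ε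
        (pbar A lam kap mu ε.toLinearMap X)) =
      shift A lam kap (Algebra.TensorProduct.rid k k (Sha A lam kap)
        (Algebra.TensorProduct.map (AlgHom.id k _) ε X)) := by
  induction X using TensorProduct.induction_on with
  | zero => simp only [map_zero]
  | add X Y hX hY => simp only [map_add, hX, hY]
  | tmul x y => simp [pbar_tmul, shiftAdd_apply, hε, mul_smul, smul_comm mu]

/-- The operator that corresponds to the shift under `(Δ ⊗ id) Δ`. -/
def tripleOp (lam kap mu : k) (ε : Sha A lam kap →ₗ[k] k) :
    Sha A lam kap ⊗[k] (Sha A lam kap ⊗[k] Sha A lam kap) →ₗ[k]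
      Sha A lam kap ⊗[k] (Sha A lam kap ⊗[k] Sha A lam kap) :=
  TensorProduct.map (shiftAdd A lam kap mu)
      (Algebra.linearMap k (Sha A lam kap ⊗[k] Sha A lam kap) ∘ₗ
        LinearMap.mul' k k ∘ₗ TensorProduct.map ε ε)
    + TensorProduct.map LinearMap.id (pbar A lam kap mu ε)

theorem tripleOp_tmul (ε : Sha A lam kap →ₗ[k] k) (x y z : Sha A lam kap) :
    tripleOp lam kap mu ε (x ⊗ₜ (y ⊗ₜ z)) =
      (ε y * ε z) • shiftAdd A lam kap mu x ⊗ₜ[k] (1 ⊗ₜ[k] 1) +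
        x ⊗ₜ pbar A lam kap mu ε (y ⊗ₜ z) := by
  simp only [tripleOp, LinearMap.add_apply, TensorProduct.map_tmul, LinearMap.comp_apply,
    LinearMap.mul'_apply, LinearMap.id_apply, Algebra.linearMap_apply,
    Algebra.algebraMap_eq_smul_one, TensorProduct.tmul_smul, Algebra.TensorProduct.one_def]

/-- The point is that `pbar + mu` sends `u ⊗ v` to `ε(v) S u ⊗ 1 + u ⊗ S v` with `S = P + mu`. This
is what `Δ` makes of `S x`, summed over the terms of `Δ x`. -/
theorem assoc_map_pbar {ε : Sha A lam kap →ₐ[k] k}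
    {Δ : Sha A lam kap →ₐ[k] Sha A lam kap ⊗[k] Sha A lam kap}
    (hΔ : ∀ x, Δ (shift A lam kap x) = pbar A lam kap mu ε.toLinearMap (Δ x))
    (X : Sha A lam kap ⊗[k] Sha A lam kap) :
    Algebra.TensorProduct.assoc k k k _ _ _ (Algebra.TensorProduct.map Δ (AlgHom.id k _)
        (pbar A lam kap mu ε.toLinearMap X)) =
      tripleOp lam kap mu ε.toLinearMap (Algebra.TensorProduct.assoc k k k _ _ _
        (Algebra.TensorProduct.map Δ (AlgHom.id k _) X)) := by
  induction X using TensorProduct.induction_on with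
  | zero => simp only [map_zero]
  | add X Y hX hY => simp only [map_add, hX, hY]
  | tmul x y =>
    simp only [pbar_tmul, shiftAdd_apply, map_add, map_smul, hΔ, Algebra.TensorProduct.map_tmul,
      -- The remaining identity is linear in `Δ x` and holds for every tensor in its place.
      AlgHom.id_apply, AlgHom.toLinearMap_apply, map_one]
    generalize Δ x = W
    induction W using TensorProduct.induction_on with
    | zero => simp
    | add V W hV hW =>
      simp only [map_add, TensorProduct.add_tmul, smul_add] at hV hW ⊢
      rw [← hV, ← hW]
      abel
    | tmul u v =>
      simp only [Algebra.TensorProduct.assoc_tmul, tripleOp_tmul, pbar_tmul, shiftAdd_apply,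
        AlgHom.toLinearMap_apply, TensorProduct.add_tmul, TensorProduct.tmul_add,
        TensorProduct.tmul_smul, ← TensorProduct.smul_tmul', map_add, map_smul, smul_add]
      module

/-- The left side carries the coefficient `ε(y)` where `tripleOp` gives `(ε ⊗ ε)(Δ y)`; `hε`
identifies the two. -/
theorem map_comul_pbar {ε : Sha A lam kap →ₐ[k] k}
    {Δ : Sha A lam kap →ₐ[k] Sha A lam kap ⊗[k] Sha A lam kap}
    (hΔ : ∀ x, Δ (shift A lam kap x) = pbar A lam kap mu ε.toLinearMap (Δ x))
    (hε : ∀ x, ε x = Algebra.TensorProduct.lmul' k (Algebra.TensorProduct.map ε ε (Δ x)))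
    (X : Sha A lam kap ⊗[k] Sha A lam kap) :
    Algebra.TensorProduct.map (AlgHom.id k _) Δ (pbar A lam kap mu ε.toLinearMap X) =
      tripleOp lam kap mu ε.toLinearMap (Algebra.TensorProduct.map (AlgHom.id k _) Δ X) := by
  induction X using TensorProduct.induction_on with
  | zero => simp only [map_zero]
  | add X Y hX hY => simp only [map_add, hX, hY]
  | tmul x y =>
    simp only [pbar_tmul, map_add, map_smul, hΔ, Algebra.TensorProduct.map_tmul,
      AlgHom.id_apply, AlgHom.toLinearMap_apply, map_one, hε y]
    -- Once `ε y` has been rewritten by `hε`, both sides depend on `y` only through `Δ y`, and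
    -- linearly.
    generalize Δ y = W
    induction W using TensorProduct.induction_on with
    | zero => simp
    | add V W hV hW =>
      simp only [map_add, TensorProduct.tmul_add, add_smul] at hV hW ⊢
      rw [← hV, ← hW]
      abel
    | tmul u v =>
      simp [tripleOp_tmul, Algebra.TensorProduct.one_def]

end Pbar

/-! ### Counit, coproduct and the coalgebra axioms. -/

section Coalgebra

variable [Bialgebra k A]

variable (A) in
/-- The counit of `Sha A`. -/
def counitHom (hmu : mu ^ 2 - lam * mu + kap = 0) : Sha A lam kap →ₐ[k] k :=
  lift (Bialgebra.counitAlgHom k A) (isExtRotaBaxter_neg_smul_id hmu)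

theorem counitHom_incl (hmu : mu ^ 2 - lam * mu + kap = 0) (a : A) :
    counitHom A hmu (incl A lam kap a) = Coalgebra.counit (R := k) a :=
  lift_incl _ _ a

theorem counitHom_shift (hmu : mu ^ 2 - lam * mu + kap = 0) (x : Sha A lam kap) :
    counitHom A hmu (shift A lam kap x) = -mu * counitHom A hmu x :=
  lift_shift _ _ x

variable (A) in
/-- The coproduct of `Sha A`. -/
def comulHom (hmu : mu ^ 2 - lam * mu + kap = 0) :
    Sha A lam kap →ₐ[k] Sha A lam kap ⊗[k] Sha A lam kap :=
  lift ((Algebra.TensorProduct.map (incl A lam kap) (incl A lam kap)).comp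
    (Bialgebra.comulAlgHom k A)) (pbar_isExtRotaBaxter hmu (counitHom_shift hmu))

theorem comulHom_incl (hmu : mu ^ 2 - lam * mu + kap = 0) (a : A) :
    comulHom A hmu (incl A lam kap a) =
      Algebra.TensorProduct.map (incl A lam kap) (incl A lam kap) (Coalgebra.comul (R := k) a) :=
  lift_incl _ _ a

theorem comulHom_shift (hmu : mu ^ 2 - lam * mu + kap = 0) (x : Sha A lam kap) :
    comulHom A hmu (shift A lam kap x) =
      pbar A lam kap mu (counitHom A hmu).toLinearMap (comulHom A hmu x) :=
  lift_shift _ _ x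

theorem lid_counit_comul (hmu : mu ^ 2 - lam * mu + kap = 0) :
    ((Algebra.TensorProduct.lid k (Sha A lam kap)).toAlgHom.comp
      (Algebra.TensorProduct.map (counitHom A hmu) (AlgHom.id k _))).comp (comulHom A hmu) =
      AlgHom.id k (Sha A lam kap) := by
  refine algHom_ext_of_comm (Q := shift A lam kap) (fun x => ?_) (fun x => rfl) fun a => ?_
  · rw [AlgHom.comp_apply, comulHom_shift]
    exact lid_map_pbar (counitHom_shift hmu) _
  -- On `A` the law is the left counit law of `A` carried along `incl`.
  · have h : (Algebra.TensorProduct.lid k (Sha A lam kap)).toAlgHom.comp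
        ((Algebra.TensorProduct.map (counitHom A hmu) (AlgHom.id k _)).comp
          (Algebra.TensorProduct.map (incl A lam kap) (incl A lam kap))) =
        ((incl A lam kap).comp (Algebra.TensorProduct.lid k A).toAlgHom).comp
          (Algebra.TensorProduct.map (Bialgebra.counitAlgHom k A) (AlgHom.id k A)) := by
      ext x <;> simp [counitHom_incl]
    rw [AlgHom.comp_apply, comulHom_incl]
    refine (AlgHom.congr_fun h _).trans ?_
    refine congrArg (incl A lam kap) ((congrArg (TensorProduct.lid k A)
      (Coalgebra.rTensor_counit_comul (R := k) a)).trans ?_)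
    simp

theorem rid_counit_comul (hmu : mu ^ 2 - lam * mu + kap = 0) :
    ((Algebra.TensorProduct.rid k k (Sha A lam kap)).toAlgHom.comp
      (Algebra.TensorProduct.map (AlgHom.id k _) (counitHom A hmu))).comp (comulHom A hmu) =
      AlgHom.id k (Sha A lam kap) := by
  refine algHom_ext_of_comm (Q := shift A lam kap) (fun x => ?_) (fun x => rfl) fun a => ?_
  · rw [AlgHom.comp_apply, comulHom_shift]
    exact rid_map_pbar (counitHom_shift hmu) _
  · have h : (Algebra.TensorProduct.rid k k (Sha A lam kap)).toAlgHom.comp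
        ((Algebra.TensorProduct.map (AlgHom.id k _) (counitHom A hmu)).comp
          (Algebra.TensorProduct.map (incl A lam kap) (incl A lam kap))) =
        ((incl A lam kap).comp (Algebra.TensorProduct.rid k k A).toAlgHom).comp
          (Algebra.TensorProduct.map (AlgHom.id k A) (Bialgebra.counitAlgHom k A)) := by
      ext x <;> simp [counitHom_incl]
    rw [AlgHom.comp_apply, comulHom_incl]
    refine (AlgHom.congr_fun h _).trans ?_
    refine congrArg (incl A lam kap) ((congrArg (TensorProduct.rid k A)
      (Coalgebra.lTensor_counit_comul (R := k) a)).trans ?_)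
    simp

/-- Obtained by applying the counit to the left counit law; it supplies the hypothesis `hε` of
`map_comul_pbar`. -/
theorem counitHom_eq_mul_comul (hmu : mu ^ 2 - lam * mu + kap = 0) (x : Sha A lam kap) :
    counitHom A hmu x = Algebra.TensorProduct.lmul' k
      (Algebra.TensorProduct.map (counitHom A hmu) (counitHom A hmu) (comulHom A hmu x)) := by
  have h : (Algebra.TensorProduct.lmul' k).comp
      (Algebra.TensorProduct.map (counitHom A hmu) (counitHom A hmu)) =
      (counitHom A hmu).comp ((Algebra.TensorProduct.lid k (Sha A lam kap)).toAlgHom.comp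
        (Algebra.TensorProduct.map (counitHom A hmu) (AlgHom.id k _))) := by
    ext x <;> simp
  exact ((AlgHom.congr_fun h (comulHom A hmu x)).trans
    (congrArg (counitHom A hmu) (AlgHom.congr_fun (lid_counit_comul hmu) x))).symm

theorem assoc_comul (hmu : mu ^ 2 - lam * mu + kap = 0) :
    ((Algebra.TensorProduct.assoc k k k (Sha A lam kap) (Sha A lam kap)
        (Sha A lam kap)).toAlgHom.comp
      (Algebra.TensorProduct.map (comulHom A hmu) (AlgHom.id k _))).comp (comulHom A hmu) =
      (Algebra.TensorProduct.map (AlgHom.id k _) (comulHom A hmu)).comp (comulHom A hmu) := by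
  refine algHom_ext_of_comm (Q := tripleOp lam kap mu (counitHom A hmu).toLinearMap)
    (fun x => ?_) (fun x => ?_) fun a => ?_
  · rw [AlgHom.comp_apply, comulHom_shift]
    exact assoc_map_pbar (comulHom_shift hmu) _
  · rw [AlgHom.comp_apply, comulHom_shift]
    exact map_comul_pbar (comulHom_shift hmu) (counitHom_eq_mul_comul hmu) _
  · let J := Algebra.TensorProduct.map (incl A lam kap) (incl A lam kap)
    -- `h1` and `h2` pull the two sides back along `incl` to the two iterated coproducts of `A`,
    -- which coassociativity of `A` identifies.
    have h1 (X : A ⊗[k] A) : Algebra.TensorProduct.assoc k k k _ _ _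
          (Algebra.TensorProduct.map (comulHom A hmu) (AlgHom.id k _) (J X)) =
        Algebra.TensorProduct.map (incl A lam kap) J (TensorProduct.assoc k A A A
          (Coalgebra.comul.rTensor A X)) := by
      induction X using TensorProduct.induction_on with
      | zero => simp only [map_zero]
      | add X Y hX hY => simp only [map_add, hX, hY]
      | tmul x y =>
        simp only [J, Algebra.TensorProduct.map_tmul, comulHom_incl, LinearMap.rTensor_tmul,
          AlgHom.id_apply]
        generalize (Coalgebra.comul (R := k) x) = W
        induction W using TensorProduct.induction_on with
        | zero => simp
        | add V W hV hW => simp only [map_add, TensorProduct.add_tmul, hV, hW]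
        | tmul u v => simp
    have h2 (X : A ⊗[k] A) :
          Algebra.TensorProduct.map (AlgHom.id k _) (comulHom A hmu) (J X) =
        Algebra.TensorProduct.map (incl A lam kap) J (Coalgebra.comul.lTensor A X) := by
      induction X using TensorProduct.induction_on with
      | zero => simp only [map_zero]
      | add X Y hX hY => simp only [map_add, hX, hY]
      | tmul x y => simp [J, comulHom_incl]
    rw [AlgHom.comp_apply, comulHom_incl]
    refine (h1 _).trans ?_
    rw [Coalgebra.coassoc_apply, AlgHom.comp_apply, comulHom_incl]
    exact (h2 _).symm

variable (A) in
/-- The coalgebra structure of `Sha A`. -/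
@[reducible]
def coalgebra (hmu : mu ^ 2 - lam * mu + kap = 0) : Coalgebra k (Sha A lam kap) where
  comul := (comulHom A hmu).toLinearMap
  counit := (counitHom A hmu).toLinearMap
  coassoc := LinearMap.ext fun x => AlgHom.congr_fun (assoc_comul hmu) x
  rTensor_counit_comp_comul := LinearMap.ext fun x =>
    (TensorProduct.lid k (Sha A lam kap)).injective <|
      (AlgHom.congr_fun (lid_counit_comul hmu) x).trans (one_smul k x).symm
  lTensor_counit_comp_comul := LinearMap.ext fun x =>
    (TensorProduct.rid k (Sha A lam kap)).injective <|
      (AlgHom.congr_fun (rid_counit_comul hmu) x).trans (one_smul k x).symm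

end Coalgebra

end Sha

end Bialgebra

end ExtRB

end

/-! ### The theorem; the Rota-Baxter claims for the three operators are the `source` and `target`
fields of the homomorphisms. -/

theorem mainTheorem3 {k : Type*} [CommRing k] {A : Type*} [CommRing A] [Bialgebra k A]
    (lam kap mu : k) (hmu : mu ^ 2 - lam * mu + kap = 0) :
    (∀ c : k, algebraMap k (ExtRB.Sha A lam kap) c = c • ExtRB.Sha.incl A lam kap 1) ∧
    ∃ ε : ExtRB.Sha A lam kap →ₐ[k] k,
      -- existence and uniqueness of the counit
      (ExtRB.IsExtRotaBaxterHom lam kap (ExtRB.Sha.shift A lam kap)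
          ((-mu) • (LinearMap.id : k →ₗ[k] k)) ε ∧
        ∀ a : A, ε (ExtRB.Sha.incl A lam kap a) = Coalgebra.counit (R := k) a) ∧
      (∀ ε' : ExtRB.Sha A lam kap →ₐ[k] k,
        ExtRB.IsExtRotaBaxterHom lam kap (ExtRB.Sha.shift A lam kap)
            ((-mu) • (LinearMap.id : k →ₗ[k] k)) ε' →
        (∀ a : A, ε' (ExtRB.Sha.incl A lam kap a) = Coalgebra.counit (R := k) a) → ε' = ε) ∧
      ∃ Δ : ExtRB.Sha A lam kap →ₐ[k] ExtRB.Sha A lam kap ⊗[k] ExtRB.Sha A lam kap,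
        -- existence and uniqueness of the coproduct
        (ExtRB.IsExtRotaBaxterHom lam kap (ExtRB.Sha.shift A lam kap)
            (ExtRB.Sha.pbar A lam kap mu ε.toLinearMap) Δ ∧
          ∀ a : A, Δ (ExtRB.Sha.incl A lam kap a) =
            Algebra.TensorProduct.map (ExtRB.Sha.incl A lam kap) (ExtRB.Sha.incl A lam kap)
              (Coalgebra.comul (R := k) a)) ∧
        (∀ Δ' : ExtRB.Sha A lam kap →ₐ[k] ExtRB.Sha A lam kap ⊗[k] ExtRB.Sha A lam kap,
          ExtRB.IsExtRotaBaxterHom lam kap (ExtRB.Sha.shift A lam kap)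
              (ExtRB.Sha.pbar A lam kap mu ε.toLinearMap) Δ' →
          (∀ a : A, Δ' (ExtRB.Sha.incl A lam kap a) =
            Algebra.TensorProduct.map (ExtRB.Sha.incl A lam kap) (ExtRB.Sha.incl A lam kap)
              (Coalgebra.comul (R := k) a)) → Δ' = Δ) ∧
        -- the algebra morphisms `Δ` and `ε` form a coalgebra structure, hence a bialgebra
        ∃ C : Coalgebra k (ExtRB.Sha A lam kap),
          C.comul = Δ.toLinearMap ∧ C.counit = ε.toLinearMap := by
  refine ⟨fun c => ?_, ExtRB.Sha.counitHom A hmu,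
    ⟨ExtRB.Sha.lift_isExtRotaBaxterHom _ _, ExtRB.Sha.counitHom_incl hmu⟩, fun ε' h h' => ?_,
    ExtRB.Sha.comulHom A hmu,
    ⟨ExtRB.Sha.lift_isExtRotaBaxterHom _ _, ExtRB.Sha.comulHom_incl hmu⟩, fun Δ' h h' => ?_,
    ExtRB.Sha.coalgebra A hmu, rfl, rfl⟩
  · rw [map_one, Algebra.algebraMap_eq_smul_one]
  · exact ExtRB.Sha.algHom_ext_of_comm h.comm (ExtRB.Sha.lift_shift _ _)
      fun a => (h' a).trans (ExtRB.Sha.counitHom_incl hmu a).symm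
  · exact ExtRB.Sha.algHom_ext_of_comm h.comm (ExtRB.Sha.comulHom_shift hmu)
      fun a => (h' a).trans (ExtRB.Sha.comulHom_incl hmu a).symm
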